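/- Let $n \ge 1$ and $k \ge 2$ be integers. Let $\mathrm{Sp}(n,1)$ be the group of all invertible $(n+1)\times(n+1)$ matrices $A$ over the quaternions $\mathbb{H}$ that preserve the Hermitian form $\langle z, w\rangle = \bar w_{n+1} z_1 + \sum_{i=2}^{n} \bar w_i z_i + \bar w_1 z_{n+1}$ on the right $\mathbb{H}$-module $\mathbb{H}^{n+1}$, and let $\mathrm{PSp}(n,1) = \mathrm{Sp}(n,1)/\{\pm I\}$, with its usual topology as a Lie group. A $k$-tuple $(g_1,\dots,g_k)$ of elements of a group $G$ is called strongly $k$-reversible if there is an element $h \in G$ with $h^2 = 1$ such that $h g_i h^{-1} = g_i^{-1}$ for all $i = 1,\dots,k$. Then the set of strongly $k$-reversible tuples in $\mathrm{PSp}(n,1)$ has Haar measure zero in the product group $\mathrm{PSp}(n,1)^k$. -/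

import Mathlib

open scoped Quaternion Matrix

noncomputable section

/-- The matrix `H₁` of the Hermitian form
`⟨z, w⟩ = w^* H₁ z = conj w_{n+1} z_1 + ∑_{i=2}^n conj w_i z_i + conj w_1 z_{n+1}`
on the right `ℍ`-module `ℍ^{n+1}`, for `n ≥ 1` (coordinates are numbered `0, …, n` here).
It exchanges the first and the last coordinate and fixes the others; the form has
signature `(n, 1)`. -/
def formMatrix (n : ℕ) : Matrix (Fin (n + 1)) (Fin (n + 1)) ℍ[ℝ] :=
  Matrix.of fun i j => if j = Equiv.swap 0 (Fin.last n) i then 1 else 0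

/-- The group `Sp(n,1)` of invertible quaternionic matrices that preserve the Hermitian form with
matrix `H₁`, i.e. that satisfy `A^* H₁ A = H₁`. -/
def SpGroup (n : ℕ) : Subgroup (Matrix (Fin (n + 1)) (Fin (n + 1)) ℍ[ℝ])ˣ where
  carrier := {A | (A : Matrix (Fin (n + 1)) (Fin (n + 1)) ℍ[ℝ])ᴴ * formMatrix n *
    (A : Matrix (Fin (n + 1)) (Fin (n + 1)) ℍ[ℝ]) = formMatrix n}
  one_mem' := by simp
  mul_mem' := by
    intro A B hA hB
    simp only [Set.mem_ofPred_eq] at hA hB ⊢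
    rw [Units.val_mul, Matrix.conjTranspose_mul]
    calc (B.val)ᴴ * (A.val)ᴴ * formMatrix n * (A.val * B.val)
        = (B.val)ᴴ * ((A.val)ᴴ * formMatrix n * A.val) * B.val := by simp only [Matrix.mul_assoc]
      _ = formMatrix n := by rw [hA, hB]
  inv_mem' := by
    intro A hA
    simp only [Set.mem_ofPred_eq] at hA ⊢
    have h1 : A.val * (A⁻¹).val = 1 := A.mul_inv
    have h2 : ((A⁻¹).val)ᴴ * (A.val)ᴴ = 1 := by
      rw [← Matrix.conjTranspose_mul, h1, Matrix.conjTranspose_one]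
    calc ((A⁻¹).val)ᴴ * formMatrix n * (A⁻¹).val
        = ((A⁻¹).val)ᴴ * ((A.val)ᴴ * formMatrix n * A.val) * (A⁻¹).val := by rw [hA]
      _ = (((A⁻¹).val)ᴴ * (A.val)ᴴ) * formMatrix n * (A.val * (A⁻¹).val) := by
          simp only [Matrix.mul_assoc]
      _ = formMatrix n := by rw [h1, h2, Matrix.one_mul, Matrix.mul_one]

/-- The subgroup `{I, -I}` of `Sp(n,1)`. -/
def plusMinusOne (n : ℕ) : Subgroup (SpGroup n) where
  carrier := {A | (A : (Matrix (Fin (n + 1)) (Fin (n + 1)) ℍ[ℝ])ˣ) = 1 ∨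
    (A : (Matrix (Fin (n + 1)) (Fin (n + 1)) ℍ[ℝ])ˣ) = -1}
  one_mem' := Or.inl rfl
  mul_mem' := by
    rintro A B (hA | hA) (hB | hB)
    · left; rw [Subgroup.coe_mul, hA, hB, one_mul]
    · right; rw [Subgroup.coe_mul, hA, hB, one_mul]
    · right; rw [Subgroup.coe_mul, hA, hB, mul_one]
    · left; rw [Subgroup.coe_mul, hA, hB, neg_mul_neg, one_mul]
  inv_mem' := by
    rintro A (hA | hA)
    · left; rw [Subgroup.coe_inv, hA, inv_one]
    · right; rw [Subgroup.coe_inv, hA, inv_neg, inv_one]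

instance plusMinusOne_normal (n : ℕ) : (plusMinusOne n).Normal where
  conj_mem := by
    rintro A (hA | hA) B
    · left; simp [hA]
    · right; simp [hA]

/-- `PSp(n,1) = Sp(n,1) / {I, -I}`. -/
def PSpGroup (n : ℕ) : Type := SpGroup n ⧸ plusMinusOne n

instance (n : ℕ) : Group (PSpGroup n) :=
  inferInstanceAs (Group (SpGroup n ⧸ plusMinusOne n))

/-- The quotient topology, where `Sp(n,1)` has the topology of a matrix group. -/
instance (n : ℕ) : TopologicalSpace (PSpGroup n) :=
  inferInstanceAs (TopologicalSpace (SpGroup n ⧸ plusMinusOne n))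

instance (n : ℕ) : IsTopologicalGroup (PSpGroup n) :=
  inferInstanceAs (IsTopologicalGroup (SpGroup n ⧸ plusMinusOne n))

instance (n : ℕ) : MeasurableSpace (PSpGroup n) := borel (PSpGroup n)

instance (n : ℕ) : BorelSpace (PSpGroup n) := ⟨rfl⟩

/-- A tuple `(g_1, …, g_k)` in a group `G` is strongly `k`-reversible if some `h : G` with
`h ^ 2 = 1` conjugates it simultaneously to `(g_1⁻¹, …, g_k⁻¹)`. -/
def IsStronglyReversible {G : Type*} [Group G] {k : ℕ} (g : Fin k → G) : Prop :=
  ∃ h : G, h ^ 2 = 1 ∧ ∀ i, h * g i * h⁻¹ = (g i)⁻¹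

end

/-!
Simultaneous conjugacy of `g` and `h` to their inverses forces a class function that is invariant
under inversion to take the same value at the word `ghgghh` and at the reversed word `hhgghg`. On
`PSp(n,1)` the square of the real part of the trace is such a function, and an explicit pair of
isometries of a hyperbolic plane shows that the difference of its two values is not identically
zero.

The zero set of this difference is null. `Sp(n,1)` is generated by quasi-reflections
`z ↦ z - v b ⟨v, z⟩`, and each of them is joined to the identity by an analytic curve of such maps.
Along every translate of such a curve the difference is analytic, so it vanishes identically or
almost nowhere; hence, by Fubini, the zero set is invariant under the generators up to null sets.
Translations act ergodically, so the zero set is null or conull, and being closed and proper it is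
null.
-/

section AnalyticCurves

open MeasureTheory Filter Set
open scoped Pointwise

theorem forall_eq_zero_or_ae_ne_zero_of_analyticOnNhd {E : Type*} [NormedAddCommGroup E]
    [NormedSpace ℝ E] {f : ℝ → E} (hf : AnalyticOnNhd ℝ f univ) :
    (∀ t, f t = 0) ∨ ∀ᵐ t, f t ≠ 0 := by
  refine or_iff_not_imp_left.2 fun h => ?_
  obtain ⟨t, ht⟩ := not_forall.1 h
  have hle := ae_restrict_le_codiscreteWithin (μ := (volume : Measure ℝ)) MeasurableSet.univ
  rw [Measure.restrict_univ] at hle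
  exact hle (hf.preimage_zero_mem_codiscrete ht)

theorem mem_aestabilizer_of_ae_smul_mem {G X : Type*} [Group G] [MulAction G X]
    [MeasurableSpace X] [MeasurableConstSMul G X] {μ : Measure X} [SMulInvariantMeasure G X μ]
    {Z : Set X} {g : G} (h : ∀ᵐ x ∂μ, x ∈ Z → g • x ∈ Z ∧ g⁻¹ • x ∈ Z) :
    g ∈ MulAction.aestabilizer G μ Z := by
  rw [MulAction.mem_aestabilizer, eventuallyEq_set]
  filter_upwards [h, (measurePreserving_smul g⁻¹ μ).quasiMeasurePreserving.ae h] with x hx hx'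
  rw [mem_smul_set_iff_inv_smul_mem]
  exact ⟨fun hxZ => smul_inv_smul g x ▸ (hx' hxZ).1, fun hxZ => (hx hxZ).2⟩

variable {G X : Type*} [Group G] [TopologicalSpace G] [MulAction G X] [TopologicalSpace X]
  [ContinuousSMul G X] [MeasurableSpace X] [BorelSpace X] {μ : Measure X}

theorem ae_forall_smul_inv_smul_mem_of_curve [ContinuousInv G] [SecondCountableTopology X]
    [SFinite μ] [SMulInvariantMeasure G X μ] {Z : Set X} (hZ : IsClosed Z) {γ : ℝ → G}
    (hγ : Continuous γ) (h : ∀ x, (∀ t, γ t • x ∈ Z) ∨ ∀ᵐ t, γ t • x ∉ Z) :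
    ∀ᵐ x ∂μ, x ∈ Z → ∀ t s, γ s • (γ t)⁻¹ • x ∈ Z := by
  have hcurve : ∀ x, ∀ᵐ t, γ t • x ∈ Z → ∀ s, γ s • x ∈ Z := fun x =>
    (h x).elim (fun hx => .of_forall fun _ _ => hx) fun hx => hx.mono fun _ ht ht' => (ht ht').elim
  have hmeas : MeasurableSet {p : X × ℝ | γ p.2 • p.1 ∈ Z → ∀ s, γ s • p.1 ∈ Z} := by
    refine .imp (hZ.preimage (by fun_prop)).measurableSet (IsClosed.measurableSet ?_)
    simp only [ofPred_forall]
    exact isClosed_iInter fun s => hZ.preimage (by fun_prop)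
  have hmeas' : MeasurableSet {p : ℝ × X | p.2 ∈ Z → ∀ s, γ s • (γ p.1)⁻¹ • p.2 ∈ Z} := by
    refine .imp (hZ.preimage continuous_snd).measurableSet (IsClosed.measurableSet ?_)
    simp only [ofPred_forall]
    exact isClosed_iInter fun s => hZ.preimage (by fun_prop)
  have hshift : ∀ᵐ t, ∀ᵐ x ∂μ, x ∈ Z → ∀ s, γ s • (γ t)⁻¹ • x ∈ Z := by
    filter_upwards [(Measure.ae_ae_comm (μ := μ) (ν := volume)
      (p := fun x t => γ t • x ∈ Z → ∀ s, γ s • x ∈ Z) hmeas).1 (.of_forall hcurve)] with t ht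
    simpa only [smul_inv_smul] using (measurePreserving_smul (γ t)⁻¹ μ).quasiMeasurePreserving.ae ht
  filter_upwards [(Measure.ae_ae_comm (μ := volume) (ν := μ)
    (p := fun t x => x ∈ Z → ∀ s, γ s • (γ t)⁻¹ • x ∈ Z) hmeas').1 hshift] with x hx hxZ
  have hdense : Dense {t | ∀ s, γ s • (γ t)⁻¹ • x ∈ Z} :=
    Measure.dense_of_ae (μ := volume) (hx.mono fun t ht => ht hxZ)
  have hclosed : IsClosed {t | ∀ s, γ s • (γ t)⁻¹ • x ∈ Z} := by
    simp only [ofPred_forall]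
    exact isClosed_iInter fun s => hZ.preimage (by fun_prop)
  exact eq_univ_iff_forall.1 (hclosed.closure_eq.symm.trans hdense.closure_eq)

theorem ae_ne_zero_of_analyticOnNhd_curves [ContinuousInv G] [SecondCountableTopology X]
    [SFinite μ] [ErgodicSMul G X μ] [μ.IsOpenPosMeasure] {E : Type*} [NormedAddCommGroup E]
    [NormedSpace ℝ E] {F : X → E} (hF : Continuous F) {S : Set G} (hS : Subgroup.closure S = ⊤)
    (hcurve : ∀ g ∈ S, ∃ γ : ℝ → G, Continuous γ ∧ γ 0 = 1 ∧ γ 1 = g ∧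
      ∀ x, AnalyticOnNhd ℝ (fun t => F (γ t • x)) univ)
    {x₀ : X} (hx₀ : F x₀ ≠ 0) : ∀ᵐ x ∂μ, F x ≠ 0 := by
  have hZ : IsClosed {x | F x = 0} := isClosed_eq hF continuous_const
  have hstab : MulAction.aestabilizer G μ {x | F x = 0} = ⊤ := by
    refine top_unique (hS.symm.le.trans ((Subgroup.closure_le _).2 fun g hg => ?_))
    obtain ⟨γ, hγ, hγ0, rfl, han⟩ := hcurve g hg
    refine mem_aestabilizer_of_ae_smul_mem ?_
    filter_upwards [ae_forall_smul_inv_smul_mem_of_curve hZ hγ fun x =>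
      forall_eq_zero_or_ae_ne_zero_of_analyticOnNhd (han x)] with x hx hxZ
    exact ⟨by simpa [hγ0] using hx hxZ 0 1, by simpa [hγ0] using hx hxZ 1 0⟩
  have hconst := MulAction.aeconst_of_aestabilizer_eq_top G hZ.measurableSet.nullMeasurableSet hstab
  refine (eventuallyConst_set.1 hconst).resolve_left fun hfull => hx₀ ?_
  exact congr_fun (Continuous.ae_eq_iff_eq μ hF continuous_const |>.1 hfull) x₀

end AnalyticCurves

section SesquilinearForms

variable {K m : Type*} [Fintype m]

/-- The form `(x, y) ↦ x^* H y` on column vectors. Columns form a right `K`-module, and a right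
scalar `c` is encoded as the scalar `MulOpposite.op c`. -/
def sesqForm [NonUnitalNonAssocSemiring K] [Star K] (H : Matrix m m K) (x y : m → K) : K :=
  star x ⬝ᵥ H *ᵥ y

section Ring

variable [Ring K] [StarRing K] (H : Matrix m m K) (x y z : m → K) (c : K)

theorem sesqForm_sub_left : sesqForm H (x - y) z = sesqForm H x z - sesqForm H y z := by
  simp only [sesqForm, star_sub, sub_dotProduct]

theorem sesqForm_sub_right : sesqForm H x (y - z) = sesqForm H x y - sesqForm H x z := by
  simp only [sesqForm, Matrix.mulVec_sub, dotProduct_sub]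

theorem sesqForm_neg_left : sesqForm H (-x) z = -sesqForm H x z := by
  simp only [sesqForm, star_neg, neg_dotProduct]

theorem sesqForm_neg_right : sesqForm H x (-z) = -sesqForm H x z := by
  simp only [sesqForm, Matrix.mulVec_neg, dotProduct_neg]

theorem sesqForm_smul_left :
    sesqForm H (MulOpposite.op c • x) y = star c * sesqForm H x y := by
  have : star (MulOpposite.op c • x) = star c • star x := by ext i; simp
  rw [sesqForm, this, smul_dotProduct, smul_eq_mul, sesqForm]

theorem sesqForm_smul_right :
    sesqForm H x (MulOpposite.op c • y) = sesqForm H x y * c := by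
  rw [sesqForm, Matrix.mulVec_smul, dotProduct_smul, op_smul_eq_mul, sesqForm]

theorem sesqForm_mulVec (A : Matrix m m K) :
    sesqForm H (A *ᵥ x) (A *ᵥ y) = sesqForm (Aᴴ * H * A) x y := by
  rw [sesqForm, sesqForm, Matrix.star_mulVec, ← Matrix.dotProduct_mulVec, Matrix.mulVec_mulVec,
    Matrix.mulVec_mulVec]

variable {H}

theorem star_sesqForm (hH : H.IsHermitian) : star (sesqForm H x y) = sesqForm H y x := by
  rw [sesqForm, ← Matrix.star_dotProduct, Matrix.star_mulVec, hH.eq, ← Matrix.dotProduct_mulVec,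
    sesqForm]

variable (H)

theorem sesqForm_single_one [DecidableEq m] (i j : m) :
    sesqForm H (Pi.single i 1) (Pi.single j 1) = H i j := by
  simp [sesqForm]

variable {H} in
theorem eq_of_forall_sesqForm_eq {H' : Matrix m m K}
    (h : ∀ x y, sesqForm H x y = sesqForm H' x y) : H = H' := by
  classical
  exact Matrix.ext fun i j => by rw [← sesqForm_single_one H, h, sesqForm_single_one]

variable [DecidableEq m]

/-- The group of invertible matrices preserving the form `sesqForm H`. -/
def isometryGroup : Subgroup (Matrix m m K)ˣ where
  carrier := {A | ∀ x y, sesqForm H (A.val *ᵥ x) (A.val *ᵥ y) = sesqForm H x y}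
  one_mem' x y := by simp
  mul_mem' hA hB x y := by simp only [Units.val_mul, ← Matrix.mulVec_mulVec, hA _ _, hB _ _]
  inv_mem' {A} hA x y := by rw [← hA]; simp

variable {H}

theorem mem_isometryGroup_iff {A : (Matrix m m K)ˣ} :
    A ∈ isometryGroup H ↔ A.valᴴ * H * A.val = H := by
  refine ⟨fun hA => eq_of_forall_sesqForm_eq fun x y => ?_, fun hA x y => ?_⟩
  · rw [← sesqForm_mulVec, hA x y]
  · rw [sesqForm_mulVec, hA]

end Ring

section DivisionRing

variable [DivisionRing K] [StarRing K]

/-- The condition on `b` under which `quasiReflection H v b` preserves the form `sesqForm H`, where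
`s` is the value of the form at `(v, v)`. -/
def IsReflectionCoeff (s b : K) : Prop := star b * s * b = b + star b

theorem isReflectionCoeff_zero (s : K) : IsReflectionCoeff s 0 := by simp [IsReflectionCoeff]

theorem isReflectionCoeff_inv_iff {s a : K} (ha : a ≠ 0) :
    IsReflectionCoeff s a⁻¹ ↔ s = a + star a := by
  have ha' : star a ≠ 0 := star_ne_zero.2 ha
  have hsum : a⁻¹ + (star a)⁻¹ = (star a)⁻¹ * (a + star a) * a⁻¹ := by
    rw [mul_add, inv_mul_cancel₀ ha', add_mul, one_mul, mul_inv_cancel_right₀ ha, add_comm]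
  rw [IsReflectionCoeff, star_inv₀, hsum, mul_left_inj' (inv_ne_zero ha),
    mul_right_inj' (inv_ne_zero ha')]

theorem IsReflectionCoeff.star {s b : K} (h : IsReflectionCoeff s b) :
    IsReflectionCoeff s (star b) := by
  obtain rfl | hb := eq_or_ne b 0
  · simpa using h
  rw [← inv_inv b, isReflectionCoeff_inv_iff (inv_ne_zero hb)] at h
  rw [← inv_inv (Star.star b), isReflectionCoeff_inv_iff (inv_ne_zero (star_ne_zero.2 hb)), h,
    star_inv₀, star_inv₀, star_star, add_comm]

variable [DecidableEq m] (H : Matrix m m K)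

/-- The matrix of the quasi-reflection `z ↦ z - v b ⟨v, z⟩`, where `⟨v, z⟩ = v^* H z`. -/
def quasiReflection (v : m → K) (b : K) : Matrix m m K :=
  1 - Matrix.vecMulVec (MulOpposite.op b • v) (star v ᵥ* H)

theorem quasiReflection_zero_right (v : m → K) : quasiReflection H v 0 = 1 := by
  simp [quasiReflection]

theorem quasiReflection_mulVec (v z : m → K) (b : K) :
    quasiReflection H v b *ᵥ z = z - MulOpposite.op (b * sesqForm H v z) • v := by
  rw [quasiReflection, Matrix.sub_mulVec, Matrix.one_mulVec, Matrix.vecMulVec_mulVec, smul_smul,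
    ← Matrix.dotProduct_mulVec, MulOpposite.op_mul, sesqForm]

theorem quasiReflection_mul_quasiReflection (v : m → K) (b c : K) :
    quasiReflection H v b * quasiReflection H v c =
      quasiReflection H v (b + c - b * sesqForm H v v * c) := by
  refine Matrix.ext_iff_mulVec.2 fun z => ?_
  rw [← Matrix.mulVec_mulVec, quasiReflection_mulVec, quasiReflection_mulVec,
    quasiReflection_mulVec, sesqForm_sub_right, sesqForm_smul_right, sub_sub, ← add_smul,
    ← MulOpposite.op_add]
  congr 3
  noncomm_ring

variable {H} {v : m → K} {b : K}

theorem quasiReflection_mul_star (hb : IsReflectionCoeff (sesqForm H v v) b) :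
    quasiReflection H v b * quasiReflection H v (star b) = 1 := by
  have h := hb.star
  rw [IsReflectionCoeff, star_star] at h
  rw [quasiReflection_mul_quasiReflection, h, add_comm, sub_self, quasiReflection_zero_right]

theorem quasiReflection_star_mul (hb : IsReflectionCoeff (sesqForm H v v) b) :
    quasiReflection H v (star b) * quasiReflection H v b = 1 := by
  simpa using quasiReflection_mul_star hb.star

theorem sesqForm_quasiReflection_mulVec (hH : H.IsHermitian)
    (hb : IsReflectionCoeff (sesqForm H v v) b) (x y : m → K) :
    sesqForm H (quasiReflection H v b *ᵥ x) (quasiReflection H v b *ᵥ y) = sesqForm H x y := by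
  have hxv := star_sesqForm v x hH
  simp only [quasiReflection_mulVec, sesqForm_sub_left, sesqForm_sub_right, sesqForm_smul_left,
    sesqForm_smul_right, star_mul, hxv]
  have hb' : sesqForm H x v * (star b * sesqForm H v v * b) * sesqForm H v y =
    sesqForm H x v * (b + star b) * sesqForm H v y := by rw [hb]
  simp only [mul_add, add_mul, mul_assoc, sub_mul] at hb' ⊢
  rw [hb']
  abel

variable (H) in
/-- The invertible matrices that are quasi-reflections preserving the form `sesqForm H`. -/
def quasiReflections : Set (Matrix m m K)ˣ :=
  {A | ∃ v b, IsReflectionCoeff (sesqForm H v v) b ∧ A.val = quasiReflection H v b}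

variable (H) in
theorem one_mem_quasiReflections : 1 ∈ quasiReflections H :=
  ⟨0, 0, isReflectionCoeff_zero _, (quasiReflection_zero_right H 0).symm⟩

theorem quasiReflections_subset_isometryGroup (hH : H.IsHermitian) :
    quasiReflections H ⊆ isometryGroup H := by
  rintro A ⟨v, b, hb, hA⟩ x y
  rw [hA, sesqForm_quasiReflection_mulVec hH hb]

theorem exists_quasiReflections_val_eq (hb : IsReflectionCoeff (sesqForm H v v) b) :
    ∃ A ∈ quasiReflections H, A.val = quasiReflection H v b :=
  ⟨⟨_, _, quasiReflection_mul_star hb, quasiReflection_star_mul hb⟩, ⟨v, b, hb, rfl⟩, rfl⟩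

theorem exists_quasiReflections_mulVec_eq (hH : H.IsHermitian) {x y : m → K}
    (hxy : sesqForm H x x = sesqForm H y y) (h : sesqForm H (x - y) x ≠ 0) :
    ∃ A ∈ quasiReflections H, A.val *ᵥ x = y ∧
      ∀ z, sesqForm H x z = 0 → sesqForm H y z = 0 → A.val *ᵥ z = z := by
  have hb : IsReflectionCoeff (sesqForm H (x - y) (x - y)) (sesqForm H (x - y) x)⁻¹ := by
    rw [isReflectionCoeff_inv_iff h, star_sesqForm _ _ hH]
    simp only [sesqForm_sub_left, sesqForm_sub_right, hxy]
    abel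
  obtain ⟨A, hA, hAval⟩ := exists_quasiReflections_val_eq hb
  refine ⟨A, hA, ?_, fun z hxz hyz => ?_⟩
  · rw [hAval, quasiReflection_mulVec, inv_mul_cancel₀ h, MulOpposite.op_one, one_smul,
      sub_sub_cancel]
  · rw [hAval, quasiReflection_mulVec, sesqForm_sub_left _ x y z, hxz, hyz, sub_self, mul_zero,
      MulOpposite.op_zero, zero_smul, sub_zero]

/-- A single quasi-reflection fails exactly when `x - y` is orthogonal to `x`; then `x + y` is not,
and one passes through `-x`. -/
theorem exists_closure_quasiReflections_mulVec_eq (hH : H.IsHermitian) (h2 : (2 : K) ≠ 0)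
    {x y : m → K} (hxy : sesqForm H x x = sesqForm H y y) (hx : sesqForm H x x ≠ 0) :
    ∃ A ∈ Subgroup.closure (quasiReflections H), A.val *ᵥ x = y ∧
      ∀ z, sesqForm H x z = 0 → sesqForm H y z = 0 → A.val *ᵥ z = z := by
  by_cases h : sesqForm H (x - y) x = 0
  · have hneg : sesqForm H (-x) (-x) = sesqForm H x x := by
      rw [sesqForm_neg_left, sesqForm_neg_right, neg_neg]
    have hA : sesqForm H (x - -x) x ≠ 0 := by
      rw [sesqForm_sub_left, sesqForm_neg_left, sub_neg_eq_add, ← two_mul]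
      exact mul_ne_zero h2 hx
    have hB : sesqForm H (-x - y) (-x) ≠ 0 := by
      rw [sesqForm_sub_left, sub_eq_zero] at h
      rw [sesqForm_neg_right, sesqForm_sub_left, sesqForm_neg_left, ← h, neg_sub, sub_neg_eq_add,
        ← two_mul]
      exact mul_ne_zero h2 hx
    obtain ⟨A, hA, hAx, hAfix⟩ := exists_quasiReflections_mulVec_eq hH hneg.symm hA
    obtain ⟨B, hB, hBx, hBfix⟩ := exists_quasiReflections_mulVec_eq hH (hneg.trans hxy) hB
    refine ⟨B * A, mul_mem (Subgroup.subset_closure hB) (Subgroup.subset_closure hA), ?_,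
      fun z hxz hyz => ?_⟩
    · rw [Units.val_mul, ← Matrix.mulVec_mulVec, hAx, hBx]
    · have hxz' : sesqForm H (-x) z = 0 := by rw [sesqForm_neg_left, hxz, neg_zero]
      rw [Units.val_mul, ← Matrix.mulVec_mulVec, hAfix z hxz hxz', hBfix z hxz' hyz]
  · obtain ⟨A, hA, hAxy⟩ := exists_quasiReflections_mulVec_eq hH hxy h
    exact ⟨A, Subgroup.subset_closure hA, hAxy⟩

theorem exists_closure_quasiReflections_forall_mulVec_eq (hH : H.IsHermitian) (h2 : (2 : K) ≠ 0)
    {ι : Type*} {e : ι → m → K} (he : Pairwise fun i j => sesqForm H (e i) (e j) = 0)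
    (he' : ∀ i, sesqForm H (e i) (e i) ≠ 0) {A : (Matrix m m K)ˣ} (hA : A ∈ isometryGroup H)
    (s : Finset ι) :
    ∃ B ∈ Subgroup.closure (quasiReflections H), ∀ i ∈ s, B.val *ᵥ e i = A.val *ᵥ e i := by
  classical
  induction s using Finset.induction with
  | empty => exact ⟨1, one_mem _, by simp⟩
  | insert j s hj ih =>
    obtain ⟨B, hB, hBA⟩ := ih
    have hBiso : B ∈ isometryGroup H :=
      (Subgroup.closure_le _).2 (quasiReflections_subset_isometryGroup hH) hB
    obtain ⟨C, hC, hCj, hCfix⟩ := exists_closure_quasiReflections_mulVec_eq hH h2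
      (x := B.val *ᵥ e j) (y := A.val *ᵥ e j) (by rw [hBiso, hA]) (by rw [hBiso]; exact he' j)
    refine ⟨C * B, mul_mem hC hB, Finset.forall_mem_insert _ _ _ |>.2 ⟨?_, fun i hi => ?_⟩⟩
    · rw [Units.val_mul, ← Matrix.mulVec_mulVec, hCj]
    · have hji : sesqForm H (e j) (e i) = 0 := he fun h => hj (h ▸ hi)
      rw [Units.val_mul, ← Matrix.mulVec_mulVec, hCfix _ (by rw [hBiso, hji])
        (by rw [hBA i hi, hA, hji]), hBA i hi]

theorem closure_quasiReflections_eq_isometryGroup (hH : H.IsHermitian) (h2 : (2 : K) ≠ 0)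
    {P : Matrix m m K} {d : m → K} (hP : Pᴴ * H * P = Matrix.diagonal d) (hd : ∀ i, d i ≠ 0) :
    Subgroup.closure (quasiReflections H) = isometryGroup H := by
  refine le_antisymm ((Subgroup.closure_le _).2 (quasiReflections_subset_isometryGroup hH))
    fun A hA => ?_
  have hform : ∀ i j, sesqForm H (P.col i) (P.col j) = Matrix.diagonal d i j := fun i j => by
    rw [← Matrix.mulVec_single_one, ← Matrix.mulVec_single_one, sesqForm_mulVec, hP,
      sesqForm_single_one]
  obtain ⟨B, hB, hBA⟩ := exists_closure_quasiReflections_forall_mulVec_eq hH h2 (e := P.col)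
    (fun i j hij => (hform i j).trans (Matrix.diagonal_apply_ne _ hij))
    (fun i => by simpa only [hform, Matrix.diagonal_apply_eq] using hd i) hA Finset.univ
  have hleft : Matrix.diagonal (fun i => (d i)⁻¹) * Pᴴ * H * P = 1 := by
    rw [Matrix.mul_assoc _ Pᴴ, Matrix.mul_assoc, hP, Matrix.diagonal_mul_diagonal]
    simp only [inv_mul_cancel₀ (hd _), Matrix.diagonal_one]
  have hBAP : B.val * P = A.val * P := Matrix.ext_of_mulVec_single fun i => by
    rw [← Matrix.mulVec_mulVec, ← Matrix.mulVec_mulVec, Matrix.mulVec_single_one,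
      hBA i (Finset.mem_univ i)]
  have hBA' : B = A := Units.ext <|
    (IsUnit.of_mul_eq_one_right _ hleft).mul_right_cancel hBAP
  exact hBA' ▸ hB

end DivisionRing
end SesquilinearForms

section FormMatrix

theorem formMatrix_apply (n : ℕ) (i j : Fin (n + 1)) :
    formMatrix n i j = if j = Equiv.swap 0 (Fin.last n) i then 1 else 0 := rfl

theorem formMatrix_isHermitian (n : ℕ) : (formMatrix n).IsHermitian :=
  Matrix.IsHermitian.ext fun i j => by
    rw [formMatrix_apply, formMatrix_apply, apply_ite star, star_one, star_zero]
    exact if_congr (eq_comm.trans Equiv.swap_apply_eq_iff) rfl rfl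

theorem formMatrix_mul_apply {n : ℕ} {p : Type*} (A : Matrix (Fin (n + 1)) p ℍ[ℝ])
    (i : Fin (n + 1)) (j : p) :
    (formMatrix n * A) i j = A (Equiv.swap 0 (Fin.last n) i) j := by
  simp [Matrix.mul_apply, formMatrix_apply]

theorem formMatrix_mul_self (n : ℕ) : formMatrix n * formMatrix n = 1 :=
  Matrix.ext fun i j => by
    rw [formMatrix_mul_apply, formMatrix_apply, Equiv.swap_apply_self, Matrix.one_apply]
    exact if_congr eq_comm rfl rfl

/-- The sign `-1` at the last coordinate if it differs from the first one, and `1` elsewhere: the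
columns of `1 + formMatrix n * diagonal (lastSign n)` are orthogonal for the form. -/
def lastSign (n : ℕ) (i : Fin (n + 1)) : ℍ[ℝ] :=
  if i ≠ 0 ∧ i = Fin.last n then -1 else 1

theorem star_lastSign (n : ℕ) : star (lastSign n) = lastSign n := by
  ext1 i
  simp only [Pi.star_apply, lastSign, apply_ite star, star_neg, star_one]

theorem lastSign_mul_self (n : ℕ) (i : Fin (n + 1)) : lastSign n i * lastSign n i = 1 := by
  unfold lastSign
  split_ifs <;> simp

theorem lastSign_of_swap_eq {n : ℕ} {i : Fin (n + 1)} (h : Equiv.swap 0 (Fin.last n) i = i) :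
    lastSign n i = 1 := by
  refine if_neg fun ⟨hi0, hi⟩ => hi0 ?_
  rw [← h, hi, Equiv.swap_apply_right]

theorem lastSign_swap_of_swap_ne {n : ℕ} {i : Fin (n + 1)}
    (h : Equiv.swap 0 (Fin.last n) i ≠ i) :
    lastSign n (Equiv.swap 0 (Fin.last n) i) = -lastSign n i := by
  obtain ⟨h0, rfl | rfl⟩ := Equiv.swap_apply_ne_self_iff.1 h <;> simp [lastSign, h0.symm]

theorem conjTranspose_mul_formMatrix_mul_eq_diagonal (n : ℕ) :
    (1 + formMatrix n * Matrix.diagonal (lastSign n))ᴴ * formMatrix n *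
      (1 + formMatrix n * Matrix.diagonal (lastSign n)) =
    Matrix.diagonal fun i =>
      2 * lastSign n i + if Equiv.swap 0 (Fin.last n) i = i then 2 else 0 := by
  set H := formMatrix n with hH
  set E := Matrix.diagonal (lastSign n) with hE
  have hHH : H * H = 1 := formMatrix_mul_self n
  have hexpand : (1 + H * E)ᴴ * H * (1 + H * E) = H + E + E + E * H * E := by
    rw [Matrix.conjTranspose_add, Matrix.conjTranspose_one, Matrix.conjTranspose_mul, hE,
      Matrix.diagonal_conjTranspose, star_lastSign, ← hE, (formMatrix_isHermitian n).eq, ← hH]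
    calc (1 + E * H) * H * (1 + H * E)
        = H + E * (H * H) + H * H * E + E * (H * H) * H * E := by noncomm_ring
      _ = H + E + E + E * H * E := by rw [hHH, mul_one, one_mul]
  rw [hexpand]
  ext1 i j
  simp only [Matrix.add_apply, hE, Matrix.mul_diagonal, Matrix.diagonal_mul, hH,
    formMatrix_apply, Matrix.diagonal_apply]
  by_cases hswap : Equiv.swap 0 (Fin.last n) i = i
  · obtain rfl | hij := eq_or_ne i j
    · norm_num [hswap, lastSign_of_swap_eq hswap]
    · simp [hswap, hij, hij.symm]
  · obtain rfl | hij := eq_or_ne i j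
    · simp [hswap, Ne.symm hswap, two_mul]
    · obtain rfl | hj := eq_or_ne j (Equiv.swap 0 (Fin.last n) i)
      · simp [hij, lastSign_swap_of_swap_ne hswap, lastSign_mul_self]
      · simp [hij, hj]

theorem closure_quasiReflections_formMatrix (n : ℕ) :
    Subgroup.closure (quasiReflections (formMatrix n)) = isometryGroup (formMatrix n) := by
  have : CharZero ℍ[ℝ] := charZero_of_injective_algebraMap (algebraMap ℝ ℍ[ℝ]).injective
  refine closure_quasiReflections_eq_isometryGroup (formMatrix_isHermitian n) two_ne_zero
    (conjTranspose_mul_formMatrix_mul_eq_diagonal n) fun i => ?_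
  split_ifs with hswap
  · rw [lastSign_of_swap_eq hswap]
    norm_num
  · simpa using left_ne_zero_of_mul_eq_one (lastSign_mul_self n i)

end FormMatrix

section ReflectionCurves

open scoped Matrix.Norms.Operator
open Set

theorem exists_star_eq_neg_forall_smul_add_smul_ne_zero {c : ℍ[ℝ]} (hc : c ≠ 0) :
    ∃ v : ℍ[ℝ], star v = -v ∧ ∀ t : ℝ, t • c + (1 - t) • v ≠ 0 := by
  by_cases him : c.im = 0
  · let i : ℍ[ℝ] := ⟨0, 1, 0, 0⟩
    have hi_re : i.re = 0 := rfl
    have hi_ne : i ≠ 0 := fun h => one_ne_zero (congrArg (·.imI) h)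
    have hc_re : c.re ≠ 0 := fun h =>
      hc (by rw [← Quaternion.re_add_im c, h, him, Quaternion.coe_zero, add_zero])
    refine ⟨i, Quaternion.star_eq_neg.2 hi_re, fun t ht => hi_ne ?_⟩
    have ht0 : t = 0 := by simpa [hi_re, hc_re] using congrArg (·.re) ht
    simpa [ht0] using ht
  · refine ⟨c.im, Quaternion.star_im c, fun t ht => him ?_⟩
    simpa using congrArg (·.im) ht

theorem exists_analyticOnNhd_isReflectionCoeff {s b : ℍ[ℝ]} (hb : IsReflectionCoeff s b) :
    ∃ β : ℝ → ℍ[ℝ], AnalyticOnNhd ℝ β univ ∧ (∀ t, IsReflectionCoeff s (β t)) ∧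
      β 0 = 0 ∧ β 1 = b := by
  obtain rfl | hb0 := eq_or_ne b 0
  · exact ⟨0, analyticOnNhd_const, fun _ => hb, rfl, rfl⟩
  obtain ⟨v, hv, hne⟩ := exists_star_eq_neg_forall_smul_add_smul_ne_zero (inv_ne_zero hb0)
  have hs : s = b⁻¹ + star b⁻¹ := by
    rwa [← isReflectionCoeff_inv_iff (inv_ne_zero hb0), inv_inv]
  refine ⟨fun t => t • (t • b⁻¹ + (1 - t) • v)⁻¹, fun t _ => ?_, fun t => ?_, ?_, ?_⟩
  · have hsegment : AnalyticAt ℝ (fun t : ℝ => t • b⁻¹ + (1 - t) • v) t := by fun_prop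
    exact analyticAt_id.smul (hsegment.inv (hne t))
  · dsimp only
    obtain rfl | ht := eq_or_ne t 0
    · simpa using isReflectionCoeff_zero s
    have hinv : t • (t • b⁻¹ + (1 - t) • v)⁻¹ = (t⁻¹ • (t • b⁻¹ + (1 - t) • v))⁻¹ := by
      rw [smul_inv₀, inv_inv]
    rw [hinv, isReflectionCoeff_inv_iff (smul_ne_zero (inv_ne_zero ht) (hne t)), hs, smul_add,
      inv_smul_smul₀ ht]
    simp only [star_add, Quaternion.star_smul, hv, smul_neg]
    abel
  · simp
  · simp

theorem analyticOnNhd_quasiReflection {m : Type*} [Fintype m] [DecidableEq m]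
    (H : Matrix m m ℍ[ℝ]) (v : m → ℍ[ℝ]) : AnalyticOnNhd ℝ (quasiReflection H v) univ := by
  let L : ℍ[ℝ] →ₗ[ℝ] Matrix m m ℍ[ℝ] :=
    { toFun b := Matrix.vecMulVec (MulOpposite.op b • v) (star v ᵥ* H)
      map_add' b c := by rw [MulOpposite.op_add, add_smul, Matrix.add_vecMulVec]
      map_smul' r b := by rw [MulOpposite.op_smul, smul_assoc, Matrix.smul_vecMulVec]; rfl }
  intro b _
  exact analyticAt_const.sub (L.toContinuousLinearMap.analyticAt b)

theorem exists_analyticOnNhd_quasiReflections {m : Type*} [Fintype m] [DecidableEq m]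
    {H : Matrix m m ℍ[ℝ]} {A : (Matrix m m ℍ[ℝ])ˣ} (hA : A ∈ quasiReflections H) :
    ∃ γ : ℝ → (Matrix m m ℍ[ℝ])ˣ, AnalyticOnNhd ℝ (fun t => (γ t).val) univ ∧
      (∀ t, γ t ∈ quasiReflections H) ∧ γ 0 = 1 ∧ γ 1 = A := by
  obtain ⟨v, b, hb, hAval⟩ := hA
  obtain ⟨β, hβ, hβcoeff, hβ0, hβ1⟩ := exists_analyticOnNhd_isReflectionCoeff hb
  choose γ hγ hγval using fun t => exists_quasiReflections_val_eq (hβcoeff t)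
  refine ⟨γ, ?_, hγ, Units.ext ?_, Units.ext ?_⟩
  · simp only [hγval]
    exact (analyticOnNhd_quasiReflection H v).comp hβ (mapsTo_univ _ _)
  · rw [hγval, hβ0, quasiReflection_zero_right, Units.val_one]
  · rw [hγval, hβ1, hAval]

theorem continuous_units_of_continuous_val {m X : Type*} [Fintype m] [DecidableEq m]
    [TopologicalSpace X] {f : X → (Matrix m m ℍ[ℝ])ˣ} (hf : Continuous fun x => (f x).val) :
    Continuous f := Units.isOpenEmbedding_val.continuous_iff.2 hf

end ReflectionCurves

section ReversalDefect

variable {G : Type*} [Group G]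

/-- The difference of the values of `φ` at a word in `g`, `h` and at the reversed word. For a class
function `φ` with `φ g⁻¹ = φ g`, it obstructs conjugating `g` and `h` simultaneously to their
inverses. As the word is not a cyclic permutation of its reversal, the difference need not vanish
for formal reasons. -/
def reversalDefect (φ : G → ℝ) (g h : G) : ℝ :=
  φ (g * h * g * g * h * h) - φ (h * h * g * g * h * g)

theorem reversalDefect_eq_zero {φ : G → ℝ} (hconj : ∀ z g, φ (z * g * z⁻¹) = φ g)
    (hinv : ∀ g, φ g⁻¹ = φ g) {g h z : G} (hg : z * g * z⁻¹ = g⁻¹) (hh : z * h * z⁻¹ = h⁻¹) :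
    reversalDefect φ g h = 0 := by
  have hword : z * (g * h * g * g * h * h) * z⁻¹ = (h * h * g * g * h * g)⁻¹ := by
    simp only [mul_inv_rev, ← hg, ← hh]
    group
  rw [reversalDefect, ← hconj z, hword, hinv, sub_self]

end ReversalDefect

section ReTrace

variable {m p : Type*} [Fintype m] [Fintype p]

/-- The real part of the trace. Unlike the trace itself, it is invariant under cyclic permutations
of products of quaternionic matrices. -/
noncomputable def reTrace : Matrix m m ℍ[ℝ] →ₗ[ℝ] ℝ :=
  QuaternionAlgebra.reₗ (-1) 0 (-1) ∘ₗ Matrix.traceLinearMap m ℝ ℍ[ℝ]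

theorem reTrace_apply (A : Matrix m m ℍ[ℝ]) : reTrace A = ∑ i, (A i i).re :=
  map_sum (QuaternionAlgebra.reₗ (-1 : ℝ) 0 (-1)) _ _

theorem reTrace_mul_apply (A : Matrix m p ℍ[ℝ]) (B : Matrix p m ℍ[ℝ]) :
    reTrace (A * B) = ∑ i, ∑ j, (A i j * B j i).re := by
  rw [reTrace_apply]
  exact Finset.sum_congr rfl fun i _ => map_sum (QuaternionAlgebra.reₗ (-1 : ℝ) 0 (-1)) _ _

theorem reTrace_mul_comm (A : Matrix m p ℍ[ℝ]) (B : Matrix p m ℍ[ℝ]) :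
    reTrace (A * B) = reTrace (B * A) := by
  rw [reTrace_mul_apply, reTrace_mul_apply, Finset.sum_comm]
  refine Finset.sum_congr rfl fun i _ => Finset.sum_congr rfl fun j _ => ?_
  simp only [Quaternion.re_mul]
  ring

theorem reTrace_conjTranspose (A : Matrix m m ℍ[ℝ]) : reTrace Aᴴ = reTrace A := by
  simp only [reTrace_apply, Matrix.conjTranspose_apply, Quaternion.re_star]

variable [DecidableEq m]

theorem reTrace_one : reTrace (1 : Matrix m m ℍ[ℝ]) = Fintype.card m := by
  simp [reTrace_apply]

theorem reTrace_units_conj (B A : (Matrix m m ℍ[ℝ])ˣ) :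
    reTrace (B * A * B⁻¹).val = reTrace A.val := by
  rw [Units.val_mul, reTrace_mul_comm, ← Units.val_mul, inv_mul_cancel_left]

theorem reTrace_inv_of_mem_isometryGroup {H : Matrix m m ℍ[ℝ]} (hH : H * H = 1)
    {A : (Matrix m m ℍ[ℝ])ˣ} (hA : A ∈ isometryGroup H) :
    reTrace A⁻¹.val = reTrace A.val := by
  have hinv : A⁻¹.val = H * (A.valᴴ * H) := Units.inv_eq_of_mul_eq_one_left <| by
    rw [Matrix.mul_assoc, mem_isometryGroup_iff.1 hA, hH]
  rw [hinv, reTrace_mul_comm, Matrix.mul_assoc, hH, Matrix.mul_one, reTrace_conjTranspose]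

end ReTrace

section Extension

variable {R m p : Type*} [Ring R] [StarRing R] [Fintype m] [Fintype p] [DecidableEq m]
  [DecidableEq p]

/-- The endomorphism of the big space that acts by `X` on the image of `J` and by the identity on
its orthogonal complement, for `J` with orthonormal columns. -/
def extendAlong (J : Matrix m p R) (X : Matrix p p R) : Matrix m m R := 1 + J * (X - 1) * Jᴴ

variable {J : Matrix m p R}

theorem extendAlong_mul (hJ : Jᴴ * J = 1) (X Y : Matrix p p R) :
    extendAlong J (X * Y) = extendAlong J X * extendAlong J Y := by
  have hcross : J * (X - 1) * Jᴴ * (J * (Y - 1) * Jᴴ) = J * ((X - 1) * (Y - 1)) * Jᴴ := by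
    calc J * (X - 1) * Jᴴ * (J * (Y - 1) * Jᴴ)
        = J * (X - 1) * (Jᴴ * J) * (Y - 1) * Jᴴ := by simp only [Matrix.mul_assoc]
      _ = J * ((X - 1) * (Y - 1)) * Jᴴ := by rw [hJ, Matrix.mul_one, Matrix.mul_assoc J]
  have hXY : X * Y - 1 = (X - 1) + (Y - 1) + (X - 1) * (Y - 1) := by noncomm_ring
  rw [extendAlong, hXY, Matrix.mul_add, Matrix.mul_add, Matrix.add_mul, Matrix.add_mul, ← hcross,
    extendAlong, extendAlong]
  noncomm_ring

theorem conjTranspose_extendAlong_mul_mul_extendAlong {H : Matrix m m R} {H' : Matrix p p R}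
    (hH : H.IsHermitian) (hH' : H'.IsHermitian) (hJ : Jᴴ * J = 1) (hHJ : H * J = J * H')
    {X : Matrix p p R} (hX : Xᴴ * H' * X = H') :
    (extendAlong J X)ᴴ * H * extendAlong J X = H := by
  have hJH : Jᴴ * H = H' * Jᴴ := by
    simpa only [Matrix.conjTranspose_mul, hH.eq, hH'.eq] using congrArg Matrix.conjTranspose hHJ
  have hadjoint : (extendAlong J X)ᴴ = 1 + J * (Xᴴ - 1) * Jᴴ := by
    simp only [extendAlong, Matrix.conjTranspose_add, Matrix.conjTranspose_one,
      Matrix.conjTranspose_mul, Matrix.conjTranspose_sub, Matrix.conjTranspose_conjTranspose,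
      Matrix.mul_assoc]
  calc (extendAlong J X)ᴴ * H * extendAlong J X
      = H + H * J * (X - 1) * Jᴴ + J * (Xᴴ - 1) * (Jᴴ * H) +
          J * (Xᴴ - 1) * (Jᴴ * H) * J * (X - 1) * Jᴴ := by
        rw [hadjoint, extendAlong]
        simp only [Matrix.add_mul, Matrix.mul_add, Matrix.one_mul, Matrix.mul_one,
          Matrix.mul_assoc]
        abel
    _ = H + J * H' * (X - 1) * Jᴴ + J * (Xᴴ - 1) * (H' * Jᴴ) +
          J * (Xᴴ - 1) * H' * (Jᴴ * J) * (X - 1) * Jᴴ := by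
        rw [hHJ, hJH]
        simp only [Matrix.mul_assoc]
    _ = H + J * (Xᴴ * H' * X - H') * Jᴴ := by
        rw [hJ]
        simp only [Matrix.mul_sub, Matrix.sub_mul, Matrix.mul_one, Matrix.mul_assoc]
        abel
    _ = H := by rw [hX, sub_self, Matrix.mul_zero, Matrix.zero_mul, add_zero]

theorem reTrace_extendAlong {J : Matrix m p ℍ[ℝ]} (hJ : Jᴴ * J = 1) (X : Matrix p p ℍ[ℝ]) :
    reTrace (extendAlong J X) = reTrace X + (Fintype.card m - Fintype.card p) := by
  rw [extendAlong, map_add, reTrace_mul_comm, ← Matrix.mul_assoc, hJ, Matrix.one_mul, map_sub,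
    reTrace_one, reTrace_one]
  ring

end Extension

section SpGroup

theorem spGroup_eq_isometryGroup (n : ℕ) : SpGroup n = isometryGroup (formMatrix n) :=
  Subgroup.ext fun _ => mem_isometryGroup_iff.symm

theorem exists_spGroup_val_eq {n : ℕ} {A : Matrix (Fin (n + 1)) (Fin (n + 1)) ℍ[ℝ]}
    (hA : Aᴴ * formMatrix n * A = formMatrix n) : ∃ B : SpGroup n, B.val.val = A := by
  have hinv : formMatrix n * Aᴴ * formMatrix n * A = 1 := by
    rw [Matrix.mul_assoc, Matrix.mul_assoc, ← Matrix.mul_assoc Aᴴ, hA, formMatrix_mul_self]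
  exact ⟨⟨⟨A, _, mul_eq_one_comm.1 hinv, hinv⟩, hA⟩, rfl⟩

namespace PSpGroup

variable {n : ℕ}

/-- The projection of `Sp(n,1)` onto `PSp(n,1)`. -/
noncomputable def mk (n : ℕ) : SpGroup n →* PSpGroup n := QuotientGroup.mk' (plusMinusOne n)

theorem mk_surjective : Function.Surjective (mk n) := QuotientGroup.mk'_surjective _

theorem isOpenQuotientMap_mk : IsOpenQuotientMap (mk n) := QuotientGroup.isOpenQuotientMap_mk

/-- The function on `PSp(n,1)` induced by the square of `reTrace`, which does not see the sign of
a matrix. -/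
noncomputable def sqReTrace : PSpGroup n → ℝ :=
  Quotient.lift (fun A : SpGroup n => reTrace A.val.val ^ 2) fun A B hAB => by
    have hB : B.val = A.val * (A⁻¹ * B).val := by rw [← Subgroup.coe_mul, mul_inv_cancel_left]
    obtain h | h := QuotientGroup.leftRel_apply.1 hAB
    · rw [hB, h, mul_one]
    · rw [hB, h, mul_neg_one, Units.val_neg, map_neg, neg_sq]

@[simp]
theorem sqReTrace_mk (A : SpGroup n) : sqReTrace (mk n A) = reTrace A.val.val ^ 2 := rfl

theorem sqReTrace_conj (z g : PSpGroup n) : sqReTrace (z * g * z⁻¹) = sqReTrace g := by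
  obtain ⟨C, rfl⟩ := mk_surjective z
  obtain ⟨A, rfl⟩ := mk_surjective g
  simp only [← map_mul, ← map_inv, sqReTrace_mk, Subgroup.coe_mul, Subgroup.coe_inv,
    reTrace_units_conj]

theorem sqReTrace_inv (g : PSpGroup n) : sqReTrace g⁻¹ = sqReTrace g := by
  obtain ⟨A, rfl⟩ := mk_surjective g
  rw [← map_inv, sqReTrace_mk, sqReTrace_mk, Subgroup.coe_inv,
    reTrace_inv_of_mem_isometryGroup (formMatrix_mul_self n) (mem_isometryGroup_iff.2 A.2)]

theorem continuous_sqReTrace : Continuous (sqReTrace (n := n)) := by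
  have hreTrace : Continuous (reTrace : Matrix (Fin (n + 1)) (Fin (n + 1)) ℍ[ℝ] → ℝ) :=
    LinearMap.continuous_of_finiteDimensional _
  exact ((hreTrace.comp (Units.continuous_val.comp continuous_subtype_val)).pow 2).quotient_lift _

end PSpGroup

end SpGroup

section ReversalWitness

/-- The inclusion of the hyperbolic plane spanned by the first and the last coordinate vector. -/
noncomputable def planeInclusion (n : ℕ) : Matrix (Fin (n + 1)) (Fin 2) ℍ[ℝ] :=
  Matrix.of fun i j => if i = ![0, Fin.last n] j then 1 else 0

theorem conjTranspose_planeInclusion_mul_self {n : ℕ} (hn : 1 ≤ n) :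
    (planeInclusion n)ᴴ * planeInclusion n = 1 := by
  have hlast : Fin.last n ≠ 0 := mt Fin.last_eq_zero_iff.1 (by lia)
  ext1 i j
  rw [Matrix.mul_apply, Finset.sum_eq_single (![0, Fin.last n] i)
    (fun x _ hx => by simp [planeInclusion, hx]) (by simp)]
  fin_cases i <;> fin_cases j <;> simp [planeInclusion, hlast, hlast.symm]

theorem formMatrix_mul_planeInclusion (n : ℕ) :
    formMatrix n * planeInclusion n = planeInclusion n * formMatrix 1 := by
  ext1 i j
  rw [formMatrix_mul_apply, Matrix.mul_apply]
  have hlast : Fin.last 1 = 1 := rfl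
  fin_cases j
  · simp [planeInclusion, formMatrix_apply, hlast, Equiv.swap_apply_eq_iff]
  · by_cases hi : i = 0 <;>
      simp [planeInclusion, formMatrix_apply, hlast, Equiv.swap_apply_eq_iff, hi]

theorem exists_plane_isometries_reTrace_words : ∃ a b : Matrix (Fin 2) (Fin 2) ℍ[ℝ],
    aᴴ * formMatrix 1 * a = formMatrix 1 ∧ bᴴ * formMatrix 1 * b = formMatrix 1 ∧
      reTrace (a * b * a * a * b * b) = 4 ∧ reTrace (b * b * a * a * b * a) = 0 := by
  obtain ⟨i, hi0, hi1, hi2, hi3⟩ : ∃ q : ℍ[ℝ], q.re = 0 ∧ q.imI = 1 ∧ q.imJ = 0 ∧ q.imK = 0 :=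
    ⟨⟨0, 1, 0, 0⟩, rfl, rfl, rfl, rfl⟩
  obtain ⟨k, hk0, hk1, hk2, hk3⟩ : ∃ q : ℍ[ℝ], q.re = 0 ∧ q.imI = 0 ∧ q.imJ = 0 ∧ q.imK = 1 :=
    ⟨⟨0, 0, 0, 1⟩, rfl, rfl, rfl, rfl⟩
  have hii : i * i = -1 := by ext <;> simp [hi0, hi1, hi2, hi3]
  have hi : star i = -i := Quaternion.star_eq_neg.2 hi0
  have hk : star k = -k := Quaternion.star_eq_neg.2 hk0
  have hform : formMatrix 1 = !![0, 1; 1, 0] := by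
    ext1 r s
    fin_cases r <;> fin_cases s <;> simp [formMatrix_apply, show Fin.last 1 = 1 from rfl]
  refine ⟨!![k, 1; 1, 0], !![i, 0; -1, i], ?_, ?_, ?_, ?_⟩
  · rw [hform]
    ext1 r s
    fin_cases r <;> fin_cases s <;> simp [Matrix.mul_apply, Fin.sum_univ_two, hk]
  · rw [hform]
    ext1 r s
    fin_cases r <;> fin_cases s <;> simp [Matrix.mul_apply, Fin.sum_univ_two, hi, hii]
  · norm_num [reTrace_apply, Fin.sum_univ_two, hi0, hi1, hi2, hi3, hk0, hk1, hk2, hk3]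
  · simp [reTrace_apply, Fin.sum_univ_two, hi0, hi1, hi2, hi3, hk0, hk1, hk2, hk3]

theorem exists_reversalDefect_sqReTrace_ne_zero {n : ℕ} (hn : 1 ≤ n) :
    ∃ g h : PSpGroup n, reversalDefect PSpGroup.sqReTrace g h ≠ 0 := by
  have hJ := conjTranspose_planeInclusion_mul_self hn
  obtain ⟨a, b, ha, hb, habaabb, hbbaaba⟩ := exists_plane_isometries_reTrace_words
  have hextend {X : Matrix (Fin 2) (Fin 2) ℍ[ℝ]} (hX : Xᴴ * formMatrix 1 * X = formMatrix 1) :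
      ∃ B : SpGroup n, B.val.val = extendAlong (planeInclusion n) X :=
    exists_spGroup_val_eq (conjTranspose_extendAlong_mul_mul_extendAlong (formMatrix_isHermitian n)
      (formMatrix_isHermitian 1) hJ (formMatrix_mul_planeInclusion n) hX)
  obtain ⟨A, hA⟩ := hextend ha
  obtain ⟨B, hB⟩ := hextend hb
  have hdefect : reversalDefect PSpGroup.sqReTrace (PSpGroup.mk n A) (PSpGroup.mk n B) =
      8 * (n + 1) := by
    simp only [reversalDefect, ← map_mul, PSpGroup.sqReTrace_mk, Subgroup.coe_mul, Units.val_mul,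
      hA, hB, ← extendAlong_mul hJ, reTrace_extendAlong hJ, habaabb, hbbaaba, Fintype.card_fin]
    push_cast
    ring
  exact ⟨_, _, hdefect.trans_ne (by positivity)⟩

end ReversalWitness

section AnalyticCurvesInPSp

open scoped Matrix.Norms.Operator
open Set

namespace PSpGroup

variable {n : ℕ}

/-- The curves in `PSp(n,1)` that lift to curves of matrices depending analytically on the
parameter. -/
def IsAnalyticCurve (c : ℝ → PSpGroup n) : Prop :=
  ∃ γ : ℝ → SpGroup n, AnalyticOnNhd ℝ (fun t => (γ t).val.val) univ ∧ ∀ t, mk n (γ t) = c t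

namespace IsAnalyticCurve

theorem const (g : PSpGroup n) : IsAnalyticCurve fun _ => g := by
  obtain ⟨A, hA⟩ := mk_surjective g
  exact ⟨fun _ => A, analyticOnNhd_const, fun _ => hA⟩

variable {c d : ℝ → PSpGroup n}

theorem mul (hc : IsAnalyticCurve c) (hd : IsAnalyticCurve d) :
    IsAnalyticCurve fun t => c t * d t := by
  obtain ⟨γ, hγ, hγc⟩ := hc
  obtain ⟨δ, hδ, hδd⟩ := hd
  exact ⟨fun t => γ t * δ t, hγ.mul hδ, fun t => by rw [map_mul, hγc, hδd]⟩

theorem continuous (hc : IsAnalyticCurve c) : Continuous c := by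
  obtain ⟨γ, hγ, hγc⟩ := hc
  have hγcont : Continuous fun t => (γ t).val.val := continuousOn_univ.1 hγ.continuousOn
  rw [← funext hγc]
  exact isOpenQuotientMap_mk.continuous.comp
    (continuous_induced_rng.2 (continuous_units_of_continuous_val hγcont))

theorem analyticOnNhd_sqReTrace (hc : IsAnalyticCurve c) :
    AnalyticOnNhd ℝ (fun t => sqReTrace (c t)) univ := by
  obtain ⟨γ, hγ, hγc⟩ := hc
  simp only [← hγc, sqReTrace_mk]
  exact ((reTrace.toContinuousLinearMap.analyticOnNhd univ).comp hγ (mapsTo_univ _ _)).pow 2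

theorem analyticOnNhd_reversalDefect (hc : IsAnalyticCurve c) (hd : IsAnalyticCurve d) :
    AnalyticOnNhd ℝ (fun t => reversalDefect sqReTrace (c t) (d t)) univ :=
  (((((hc.mul hd).mul hc).mul hc).mul hd).mul hd).analyticOnNhd_sqReTrace.sub
    (((((hd.mul hd).mul hc).mul hc).mul hd).mul hc).analyticOnNhd_sqReTrace

end IsAnalyticCurve

/-- The classes in `PSp(n,1)` of the quasi-reflections of the form. -/
def reflections (n : ℕ) : Set (PSpGroup n) :=
  mk n '' (Subtype.val ⁻¹' quasiReflections (formMatrix n))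

theorem one_mem_reflections : 1 ∈ reflections n :=
  ⟨1, one_mem_quasiReflections _, map_one _⟩

theorem closure_reflections : Subgroup.closure (reflections n) = ⊤ := by
  have hclosure {G : Type} [Group G] {S : Set G} {K : Subgroup G} (hK : Subgroup.closure S = K) :
      Subgroup.closure ((Subtype.val : K → G) ⁻¹' S) = ⊤ := by
    subst hK
    exact Subgroup.closure_closure_coe_preimage
  rw [reflections, ← MonoidHom.map_closure,
    hclosure ((closure_quasiReflections_formMatrix n).trans (spGroup_eq_isometryGroup n).symm),
    ← MonoidHom.range_eq_map, MonoidHom.range_eq_top.2 mk_surjective]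

theorem exists_isAnalyticCurve_of_mem_reflections {g : PSpGroup n} (hg : g ∈ reflections n) :
    ∃ c : ℝ → PSpGroup n, IsAnalyticCurve c ∧ c 0 = 1 ∧ c 1 = g := by
  obtain ⟨A, hA, rfl⟩ := hg
  obtain ⟨γ, hγ, hγmem, hγ0, hγ1⟩ := exists_analyticOnNhd_quasiReflections hA
  have hγSp (t : ℝ) : γ t ∈ SpGroup n :=
    spGroup_eq_isometryGroup n ▸
      quasiReflections_subset_isometryGroup (formMatrix_isHermitian n) (hγmem t)
  refine ⟨fun t => mk n ⟨γ t, hγSp t⟩, ⟨_, hγ, fun _ => rfl⟩, ?_, congrArg _ (Subtype.ext hγ1)⟩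
  exact (congrArg _ (Subtype.ext hγ0)).trans (map_one (mk n))

end PSpGroup

end AnalyticCurvesInPSp

section Topology

instance (m : Type*) [Finite m] : SecondCountableTopology (Matrix m m ℍ[ℝ]) :=
  haveI : ProperSpace ℍ[ℝ] := FiniteDimensional.proper ℝ ℍ[ℝ]
  inferInstanceAs (SecondCountableTopology (m → m → ℍ[ℝ]))

instance (m : Type*) [Finite m] : LocallyCompactSpace (Matrix m m ℍ[ℝ]) :=
  haveI : ProperSpace ℍ[ℝ] := FiniteDimensional.proper ℝ ℍ[ℝ]
  inferInstanceAs (LocallyCompactSpace (m → m → ℍ[ℝ]))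

theorem isClosed_spGroup (n : ℕ) :
    IsClosed (SpGroup n : Set (Matrix (Fin (n + 1)) (Fin (n + 1)) ℍ[ℝ])ˣ) := by
  have hcont : Continuous fun A : (Matrix (Fin (n + 1)) (Fin (n + 1)) ℍ[ℝ])ˣ =>
      A.valᴴ * formMatrix n * A.val := by
    have := Units.continuous_val (M := Matrix (Fin (n + 1)) (Fin (n + 1)) ℍ[ℝ])
    fun_prop
  exact isClosed_singleton.preimage hcont

instance (n : ℕ) : LocallyCompactSpace (SpGroup n) := (isClosed_spGroup n).locallyCompactSpace

instance (n : ℕ) : LocallyCompactSpace (PSpGroup n) :=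
  inferInstanceAs (LocallyCompactSpace (SpGroup n ⧸ plusMinusOne n))

open scoped Matrix.Norms.Operator in
instance (n : ℕ) : SecondCountableTopology (PSpGroup n) :=
  haveI : SecondCountableTopology (Matrix (Fin (n + 1)) (Fin (n + 1)) ℍ[ℝ])ˣ :=
    Units.isOpenEmbedding_val.isEmbedding.secondCountableTopology
  haveI : SecondCountableTopology (SpGroup n) :=
    Topology.IsEmbedding.subtypeVal.secondCountableTopology
  PSpGroup.isOpenQuotientMap_mk.isQuotientMap.secondCountableTopology
    PSpGroup.isOpenQuotientMap_mk.isOpenMap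

end Topology

theorem ae_reversalDefect_sqReTrace_ne_zero {ι : Type*} [Finite ι] {n : ℕ} (hn : 1 ≤ n) {a b : ι}
    (hab : a ≠ b) (μ : MeasureTheory.Measure (ι → PSpGroup n)) [μ.IsHaarMeasure] :
    ∀ᵐ g ∂μ, reversalDefect PSpGroup.sqReTrace (g a) (g b) ≠ 0 := by
  classical
  obtain ⟨x, y, hxy⟩ := exists_reversalDefect_sqReTrace_ne_zero hn
  have hcont : Continuous fun g : ι → PSpGroup n =>
      reversalDefect PSpGroup.sqReTrace (g a) (g b) :=
    (PSpGroup.continuous_sqReTrace.comp (by fun_prop)).sub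
      (PSpGroup.continuous_sqReTrace.comp (by fun_prop))
  have hgen : Subgroup.closure (Set.univ.pi fun _ : ι => PSpGroup.reflections n) = ⊤ := by
    rw [Subgroup.closure_pi fun _ => PSpGroup.one_mem_reflections]
    simp only [PSpGroup.closure_reflections, Subgroup.pi_top]
  refine ae_ne_zero_of_analyticOnNhd_curves hcont hgen (fun g hg => ?_)
    (x₀ := Function.update (fun _ => x) b y) (by simpa [hab] using hxy)
  choose c hc hc0 hc1 using fun i =>
    PSpGroup.exists_isAnalyticCurve_of_mem_reflections (hg i (Set.mem_univ i))
  exact ⟨fun t i => c i t, continuous_pi fun i => (hc i).continuous, funext hc0, funext hc1,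
    fun x => ((hc a).mul (.const (x a))).analyticOnNhd_reversalDefect
      ((hc b).mul (.const (x b)))⟩

theorem mainTheorem9_general (n k : ℕ) (hn : 1 ≤ n) (hk : 2 ≤ k)
    (μ : MeasureTheory.Measure (Fin k → PSpGroup n)) [μ.IsHaarMeasure] :
    μ {g : Fin k → PSpGroup n | ∃ h : PSpGroup n, ∀ i, h * g i * h⁻¹ = (g i)⁻¹} = 0 := by
  have hne : (⟨0, by lia⟩ : Fin k) ≠ ⟨1, by lia⟩ := by simp
  refine MeasureTheory.measure_mono_null ?_
    (MeasureTheory.ae_iff.1 (ae_reversalDefect_sqReTrace_ne_zero hn hne μ))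
  rintro g ⟨h, hg⟩
  exact not_not.2 (reversalDefect_eq_zero PSpGroup.sqReTrace_conj PSpGroup.sqReTrace_inv
    (hg _) (hg _))

theorem mainTheorem9 (n k : ℕ) (hn : 1 ≤ n) (hk : 2 ≤ k)
    (μ : MeasureTheory.Measure (Fin k → PSpGroup n)) [μ.IsHaarMeasure] :
    μ {g : Fin k → PSpGroup n | IsStronglyReversible g} = 0 :=
  MeasureTheory.measure_mono_null (fun _ hg => hg.imp fun _ h => h.2)
    (mainTheorem9_general n k hn hk μ)
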